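/- For a permutation $\pi\in S_n$ let $c_1(\pi)$ denote the number of $1$-cycles (fixed points) of $\pi$, and for an integer $k\ge 0$ let $\sigma_k(q)=\sum_{d\mid q}d^k$ be the divisor function. There are universal constants $q_0\in\mathbb N$ and $C$ such that for all integers $q\ge q_0$, all integers $\delta\ge 1$ with $\delta\le \frac{\log q}{\log 2}$ and all integers $n\ge\delta q$, the moment \[ M:=\frac1{n!}\sum_{\pi\in S_n}\bigl(c_1(\pi^q)\bigr)^{\delta} \] satisfies \[ \begin{aligned} M&=\sigma_0(q) &&\text{if }\delta=1,\\ M&=\sigma_1(q)+\sigma_0(q)^2 &&\text{if }\delta=2,\\ |M-\sigma_2(q)|&\le C\,\sigma_0(q)\,\sigma_1(q) &&\text{if }\delta=3,\\ |M-\sigma_{\delta-1}(q)|&\le C\,q^{\delta-2}\bigl(\delta\,\sigma_0(q)+2^{\delta}\bigr) &&\text{if }\delta\ge 4. \end{aligned} \] In particular the constants do not depend on $q$, $\delta$ or $n$. -/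

import Mathlib

/-- `cycleCount i π` is the number `c_i(π)` of cycles of length `i` in the cycle decomposition of
`π ∈ S_n`. Here `π.partition` is the cycle type of `π` as a partition of `n`, with
the fixed points included as parts equal to `1`. -/
def cycleCount {n : ℕ} (i : ℕ) (π : Equiv.Perm (Fin n)) : ℕ :=
  π.partition.parts.count i

/-- The `δ`-th moment `(1/n!) ∑_{π ∈ S_n} c_1(π^q)^δ` of `c_1(π^q)` over the symmetric group. -/
noncomputable def fixedPointMoment (n q δ : ℕ) : ℝ :=
  (1 / (Nat.factorial n : ℝ)) * ∑ π : Equiv.Perm (Fin n), (cycleCount 1 (π ^ q) : ℝ) ^ δ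

/-! A `d`-cycle becomes trivial in `π ^ q` exactly when `d ∣ q`, so `c₁(π^q) = ∑_{d ∣ q} d c_d(π)`.
Deleting a `d`-cycle gives `E_n[d c_d G(s)] = E_{n-d}[G(d ::ₘ s)]` (`partitionAverage_mul_count`).
Applied to one factor of the power, this expresses the moment through lower moments. Induction shows
independence of `n` for `n ≥ δq`, whence `M_{δ+1} = ∑_{k ≤ δ} C(δ,k) σ_k(q) M_{δ-k}`
(`stableMoment_succ`), with top term `σ_δ(q)`.

The cases `δ ≤ 3` are read off directly. For larger `δ`, put `a_k = σ_k/q^k` and `b_N =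
M_{N+1}/q^N`; then `b_N = a_N + (1/q) ∑_{k<N} C(N,k) a_k b_{N-1-k}`. Only `a_0, a_1, b_0, b_1` can
be large, so `2^(N+1) ≤ q` keeps the other `b_N` bounded (`recurrence_le`); feeding this back makes
the sum `O(N a_0 + 2^N)` (`recurrence_sub_le`). -/

/-! ### Fixed points of a power from the cycle type -/

/-- The sum of the parts of `s` that divide `q`. -/
def divisorWeight (q : ℕ) (s : Multiset ℕ) : ℕ := (s.filter (· ∣ q)).sum

/-- The order of the centralizer of a permutation whose cycle lengths, fixed points included,
form the multiset `s`. -/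
def centralizerOrder (s : Multiset ℕ) : ℕ := s.prod * ∏ i ∈ s.toFinset, (s.count i).factorial

lemma divisorWeight_add (q : ℕ) (s t : Multiset ℕ) :
    divisorWeight q (s + t) = divisorWeight q s + divisorWeight q t := by
  simp [divisorWeight]

lemma divisorWeight_cons_of_dvd {q d : ℕ} (h : d ∣ q) (s : Multiset ℕ) :
    divisorWeight q (d ::ₘ s) = d + divisorWeight q s := by
  simp [divisorWeight, h]

lemma divisorWeight_eq_sum_divisors {q : ℕ} (hq : q ≠ 0) (s : Multiset ℕ) :
    divisorWeight q s = ∑ d ∈ q.divisors, d * s.count d := by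
  induction s using Multiset.induction_on with
  | empty => simp [divisorWeight]
  | cons a s ih =>
    have h1 : divisorWeight q (a ::ₘ s) = (if a ∣ q then a else 0) + divisorWeight q s := by
      by_cases h : a ∣ q <;> simp [divisorWeight, h]
    rw [h1, ih]
    simp only [Multiset.count_cons, mul_add, Finset.sum_add_distrib]
    rw [add_comm]
    congr 1
    simp [hq]

/-- A power of a single cycle is either trivial or moves every point of the cycle; both sides add
over disjoint products. -/
lemma card_support_pow_add_divisorWeight {α : Type*} [Fintype α] [DecidableEq α]
    (σ : Equiv.Perm α) (q : ℕ) :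
    (σ ^ q).support.card + divisorWeight q σ.cycleType = σ.support.card := by
  induction σ using Equiv.Perm.cycle_induction_on with
  | base_one => simp [divisorWeight]
  | base_cycles σ hσ =>
    rw [hσ.cycleType]
    by_cases h : orderOf σ ∣ q
    · rw [orderOf_dvd_iff_pow_eq_one.1 h]
      rw [hσ.orderOf] at h
      simp [divisorWeight, Multiset.filter_singleton, h]
    · rw [hσ.support_pow_eq_iff.2 h]
      rw [hσ.orderOf] at h
      simp [divisorWeight, Multiset.filter_singleton, h]
  | induction_disjoint σ τ hd _ hσ hτ =>
    rw [hd.cycleType_mul, divisorWeight_add, hd.commute.mul_pow,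
      (hd.pow_disjoint_pow q q).card_support_mul, hd.card_support_mul]
    omega

lemma cycleCount_one_pow {n : ℕ} (π : Equiv.Perm (Fin n)) (q : ℕ) :
    cycleCount 1 (π ^ q) = divisorWeight q π.partition.parts := by
  have h := card_support_pow_add_divisorWeight π q
  have h1 : Multiset.count 1 (π ^ q).cycleType = 0 :=
    Multiset.count_eq_zero.2 fun h => absurd (Equiv.Perm.two_le_of_mem_cycleType h) (by norm_num)
  have h2 : ∀ c, divisorWeight q (Multiset.replicate c 1) = c := fun c => by
    rw [divisorWeight, Multiset.filter_eq_self.2] <;> simp +contextual [Multiset.mem_replicate]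
  have h3 := Finset.card_le_univ π.support
  rw [cycleCount, Equiv.Perm.parts_partition, Equiv.Perm.parts_partition, Multiset.count_add,
    Multiset.count_replicate_self, divisorWeight_add, h1, h2]
  omega

/-! ### Averages over the symmetric group as sums over partitions -/

lemma centralizerOrder_eq_of_subset {s : Multiset ℕ} {T : Finset ℕ} (h : s.toFinset ⊆ T) :
    centralizerOrder s = s.prod * ∏ i ∈ T, (s.count i).factorial := by
  rw [centralizerOrder, Finset.prod_subset h]
  intro i _ hi
  rw [Multiset.mem_toFinset] at hi
  simp [Multiset.count_eq_zero.2 hi]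

lemma centralizerOrder_cons (d : ℕ) (s : Multiset ℕ) :
    centralizerOrder (d ::ₘ s) = d * (s.count d + 1) * centralizerOrder s := by
  have hd : d ∈ (d ::ₘ s).toFinset := by simp
  have hs : s.toFinset ⊆ (d ::ₘ s).toFinset := by
    intro i; simp +contextual
  rw [centralizerOrder_eq_of_subset hs, centralizerOrder, ← Finset.mul_prod_erase _ _ hd,
    ← Finset.mul_prod_erase _ _ hd, Multiset.prod_cons, Multiset.count_cons_self,
    Nat.factorial_succ]
  have : ∏ i ∈ (d ::ₘ s).toFinset.erase d, ((d ::ₘ s).count i).factorial =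
      ∏ i ∈ (d ::ₘ s).toFinset.erase d, (s.count i).factorial :=
    Finset.prod_congr rfl fun i hi => by
      rw [Multiset.count_cons_of_ne (Finset.ne_of_mem_erase hi)]
  rw [this]
  ring

lemma centralizerOrder_pos {s : Multiset ℕ} (hs : ∀ i ∈ s, 0 < i) : 0 < centralizerOrder s :=
  Nat.mul_pos (Multiset.prod_pos hs) (Finset.prod_pos fun _ _ => Nat.factorial_pos _)

lemma filter_two_le_add_replicate {s : Multiset ℕ} (hs : ∀ i ∈ s, 0 < i) :
    s.filter (2 ≤ ·) + Multiset.replicate (s.count 1) 1 = s := by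
  conv_rhs => rw [← Multiset.filter_add_not (2 ≤ ·) s]
  congr 1
  rw [← Multiset.filter_eq']
  refine Multiset.filter_congr fun i hi => ?_
  have := hs i hi
  omega

lemma card_partition_eq_mul_centralizerOrder {n : ℕ} (p : n.Partition) :
    (Finset.univ.filter fun π : Equiv.Perm (Fin n) => π.partition.parts = p.parts).card *
      centralizerOrder p.parts = n.factorial := by
  set s := p.parts with hs
  set m := s.filter (2 ≤ ·) with hm
  have hsm : m + Multiset.replicate (s.count 1) 1 = s :=
    filter_two_le_add_replicate fun i hi => p.parts_pos hi
  have hsum : m.sum + s.count 1 = n := by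
    have := congrArg Multiset.sum hsm
    rw [Multiset.sum_add, Multiset.sum_replicate, hs, p.parts_sum] at this
    simpa using this
  have hiff : ∀ π : Equiv.Perm (Fin n), π.partition.parts = s ↔ π.cycleType = m := by
    intro π
    constructor
    · intro h
      rw [← Equiv.Perm.filter_parts_partition_eq_cycleType, h]
    · intro h
      rw [Equiv.Perm.parts_partition, h, ← Equiv.Perm.sum_cycleType, h, Fintype.card_fin,
        show n - m.sum = s.count 1 by omega, hsm]
  -- `cycleType` omits fixed points, which enter the class formula only through `(n - m.sum)!`, the
  -- factor of the part `1`.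
  have hz : centralizerOrder s =
      (n - m.sum).factorial * m.prod * ∏ i ∈ m.toFinset, (m.count i).factorial := by
    have h1 : 1 ∉ m.toFinset := by simp [hm]
    have hsub : s.toFinset ⊆ insert 1 m.toFinset := by
      intro i hi
      rw [← hsm] at hi
      simp only [Multiset.mem_toFinset, Multiset.mem_add, Multiset.mem_replicate] at hi
      simp only [Finset.mem_insert, Multiset.mem_toFinset]
      tauto
    rw [centralizerOrder_eq_of_subset hsub, Finset.prod_insert h1,
      show n - m.sum = s.count 1 by omega]
    have hp : s.prod = m.prod := by
      conv_lhs => rw [← hsm]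
      simp
    have hc : ∏ i ∈ m.toFinset, (s.count i).factorial =
        ∏ i ∈ m.toFinset, (m.count i).factorial :=
      Finset.prod_congr rfl fun i hi => by
        rw [hm, Multiset.count_filter_of_pos]
        rw [hm, Multiset.mem_toFinset, Multiset.mem_filter] at hi
        exact hi.2
    rw [hp, hc]
    ring
  have h := Equiv.Perm.card_of_cycleType_mul_eq (Fin n) m
  rw [if_pos ⟨by simp; omega, fun a ha => (Multiset.mem_filter.1 ha).2⟩, Fintype.card_fin] at h
  simp_rw [hiff, hz]
  exact h

/-- The average over `S_n` of a function of the cycle lengths, as a sum over partitions. -/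
noncomputable def partitionAverage (n : ℕ) (F : Multiset ℕ → ℝ) : ℝ :=
  ∑ p : n.Partition, F p.parts / centralizerOrder p.parts

lemma average_perm_eq_partitionAverage (n : ℕ) (F : Multiset ℕ → ℝ) :
    (1 / (n.factorial : ℝ)) * ∑ π : Equiv.Perm (Fin n), F π.partition.parts =
      partitionAverage n F := by
  -- `π.partition` partitions `Fintype.card (Fin n)`, so it is repackaged as a partition of `n`.
  let f : Equiv.Perm (Fin n) → n.Partition := fun π =>
    ⟨π.partition.parts, fun h => π.partition.parts_pos h, by simp [π.partition.parts_sum]⟩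
  rw [← Finset.sum_fiberwise Finset.univ f, Finset.mul_sum]
  refine Finset.sum_congr rfl fun p _ => ?_
  have hcard := card_partition_eq_mul_centralizerOrder p
  have hfilter : (Finset.univ.filter fun π => f π = p) =
      Finset.univ.filter fun π : Equiv.Perm (Fin n) => π.partition.parts = p.parts := by
    ext π
    simp [f, Nat.Partition.ext_iff]
  have hz : (centralizerOrder p.parts : ℝ) ≠ 0 := by
    exact_mod_cast (centralizerOrder_pos fun i hi => p.parts_pos hi).ne'
  rw [hfilter, Finset.sum_congr rfl (g := fun _ => F p.parts), Finset.sum_const, nsmul_eq_mul,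
    ← hcard]
  · have hk : ((Finset.univ.filter fun π : Equiv.Perm (Fin n) =>
        π.partition.parts = p.parts).card : ℝ) ≠ 0 := by
      have : n.factorial ≠ 0 := n.factorial_ne_zero
      rw [← hcard] at this
      exact_mod_cast left_ne_zero_of_mul this
    push_cast
    field_simp
  · intro π hπ
    rw [(Finset.mem_filter.1 hπ).2]

/-- Erasing one part `d` is a bijection onto partitions of `n - d`, and it divides the centralizer
order by exactly `d * s.count d`. -/
lemma partitionAverage_mul_count {n d : ℕ} (hd : 0 < d) (hdn : d ≤ n) (G : Multiset ℕ → ℝ) :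
    partitionAverage n (fun s => d * s.count d * G s) =
      partitionAverage (n - d) fun s => G (d ::ₘ s) := by
  unfold partitionAverage
  rw [← Finset.sum_filter_of_ne (p := fun p : n.Partition => d ∈ p.parts)]
  · refine Finset.sum_bij' (i := fun p hp => (⟨p.parts.erase d,
        fun h => p.parts_pos (Multiset.mem_of_mem_erase h), ?_⟩ : (n - d).Partition))
      (j := fun p _ => (⟨d ::ₘ p.parts, fun h => ?_, ?_⟩ : n.Partition)) ?_ ?_ ?_ ?_ ?_
    · have := Multiset.sum_erase (Finset.mem_filter.1 hp).2
      rw [p.parts_sum] at this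
      omega
    · rcases Multiset.mem_cons.1 h with rfl | h
      · exact hd
      · exact p.parts_pos h
    · rw [Multiset.sum_cons, p.parts_sum]
      omega
    · simp
    · simp
    · intro p hp
      ext1
      exact Multiset.cons_erase (Finset.mem_filter.1 hp).2
    · intro p hp
      ext1
      simp
    · intro p hp
      have hc := Multiset.cons_erase (Finset.mem_filter.1 hp).2
      have h1 := centralizerOrder_cons d (p.parts.erase d)
      have h2 : p.parts.count d = (p.parts.erase d).count d + 1 := by
        conv_lhs => rw [← hc]
        simp
      have hz : (centralizerOrder (p.parts.erase d) : ℝ) ≠ 0 := by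
        exact_mod_cast (centralizerOrder_pos fun i hi =>
          p.parts_pos (Multiset.mem_of_mem_erase hi)).ne'
      have hd' : (d : ℝ) ≠ 0 := by exact_mod_cast hd.ne'
      simp only [hc] at h1 ⊢
      rw [h1, h2]
      push_cast
      field_simp
  · intro p _ hp
    by_contra h
    exact hp (by simp [Multiset.count_eq_zero.2 h])

/-! ### Moment recursion and independence of `n` -/

lemma fixedPointMoment_eq_partitionAverage (n q δ : ℕ) :
    fixedPointMoment n q δ = partitionAverage n fun s => (divisorWeight q s : ℝ) ^ δ := by
  rw [← average_perm_eq_partitionAverage]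
  simp only [fixedPointMoment, cycleCount_one_pow]

lemma partitionAverage_sum {ι : Type*} (n : ℕ) (T : Finset ι) (F : ι → Multiset ℕ → ℝ) :
    partitionAverage n (fun s => ∑ i ∈ T, F i s) = ∑ i ∈ T, partitionAverage n (F i) := by
  unfold partitionAverage
  rw [Finset.sum_comm]
  simp only [Finset.sum_div]

lemma partitionAverage_const_mul (n : ℕ) (c : ℝ) (F : Multiset ℕ → ℝ) :
    partitionAverage n (fun s => c * F s) = c * partitionAverage n F := by
  simp only [partitionAverage, Finset.mul_sum, mul_div_assoc]

lemma fixedPointMoment_zero (n q : ℕ) : fixedPointMoment n q 0 = 1 := by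
  have : (n.factorial : ℝ) ≠ 0 := by exact_mod_cast n.factorial_ne_zero
  simp [fixedPointMoment, Fintype.card_perm, this]

lemma fixedPointMoment_succ_of_le {n q : ℕ} (hq : q ≠ 0) (hqn : q ≤ n) (δ : ℕ) :
    fixedPointMoment n q (δ + 1) = ∑ d ∈ q.divisors, ∑ k ∈ Finset.range (δ + 1),
      (δ.choose k : ℝ) * (d : ℝ) ^ k * fixedPointMoment (n - d) q (δ - k) := by
  simp only [fixedPointMoment_eq_partitionAverage]
  have h1 : (fun s : Multiset ℕ => (divisorWeight q s : ℝ) ^ (δ + 1)) = fun s =>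
      ∑ d ∈ q.divisors, (d * s.count d * (divisorWeight q s : ℝ) ^ δ) := by
    funext s
    rw [pow_succ', ← Finset.sum_mul]
    congr 1
    rw [divisorWeight_eq_sum_divisors hq]
    push_cast
    rfl
  rw [h1, partitionAverage_sum]
  refine Finset.sum_congr rfl fun d hd => ?_
  have hdq := Nat.dvd_of_mem_divisors hd
  rw [partitionAverage_mul_count (Nat.pos_of_mem_divisors hd)
    ((Nat.le_of_dvd (Nat.pos_of_ne_zero hq) hdq).trans hqn) fun s => (divisorWeight q s : ℝ) ^ δ]
  simp only [← partitionAverage_const_mul]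
  rw [← partitionAverage_sum]
  congr 1
  funext s
  rw [divisorWeight_cons_of_dvd hdq]
  push_cast
  rw [add_pow]
  exact Finset.sum_congr rfl fun k _ => by ring

lemma fixedPointMoment_eq_of_le {q : ℕ} (hq : q ≠ 0) (δ : ℕ) :
    ∀ n n' : ℕ, δ * q ≤ n → δ * q ≤ n' → fixedPointMoment n q δ = fixedPointMoment n' q δ := by
  induction δ using Nat.strong_induction_on with
  | _ δ ih =>
    intro n n' hn hn'
    rcases δ with _ | δ
    · simp only [fixedPointMoment_zero]
    · have hle : (δ + 1) * q = δ * q + q := by ring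
      rw [fixedPointMoment_succ_of_le hq (by omega), fixedPointMoment_succ_of_le hq (by omega)]
      refine Finset.sum_congr rfl fun d hd => Finset.sum_congr rfl fun k _ => ?_
      have hdq := Nat.divisor_le hd
      have hk : (δ - k) * q ≤ δ * q := Nat.mul_le_mul_right _ (Nat.sub_le _ _)
      -- Removing a cycle costs `d ≤ q` points, while the exponent falls by at least one.
      rw [ih (δ - k) (by omega) (n - d) (n' - d) (by omega) (by omega)]

/-- The common value of the `δ`-th moments of `c_1(π^q)` over `S_n` for `n ≥ δ q`. -/
noncomputable def stableMoment (q δ : ℕ) : ℝ := fixedPointMoment (δ * q) q δ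

lemma fixedPointMoment_eq_stableMoment {n q δ : ℕ} (hq : q ≠ 0) (hn : δ * q ≤ n) :
    fixedPointMoment n q δ = stableMoment q δ :=
  fixedPointMoment_eq_of_le hq δ n _ hn le_rfl

lemma stableMoment_zero (q : ℕ) : stableMoment q 0 = 1 := fixedPointMoment_zero _ _

lemma stableMoment_nonneg (q δ : ℕ) : 0 ≤ stableMoment q δ := by
  unfold stableMoment fixedPointMoment
  positivity

lemma stableMoment_succ {q : ℕ} (hq : q ≠ 0) (δ : ℕ) :
    stableMoment q (δ + 1) = ∑ k ∈ Finset.range (δ + 1),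
      (δ.choose k : ℝ) * (ArithmeticFunction.sigma k q : ℝ) * stableMoment q (δ - k) := by
  have hle : (δ + 1) * q = δ * q + q := by ring
  rw [stableMoment, fixedPointMoment_succ_of_le hq (by omega), Finset.sum_comm]
  refine Finset.sum_congr rfl fun k _ => ?_
  rw [ArithmeticFunction.sigma_apply]
  push_cast
  rw [Finset.mul_sum, Finset.sum_mul]
  refine Finset.sum_congr rfl fun d hd => ?_
  have hdq := Nat.divisor_le hd
  have hk : (δ - k) * q ≤ δ * q := Nat.mul_le_mul_right _ (Nat.sub_le _ _)
  rw [fixedPointMoment_eq_stableMoment hq (by omega)]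

/-! ### Estimates for divisor sums -/

lemma card_divisors_sq_le {q : ℕ} (hq : q ≠ 0) : q.divisors.card ^ 2 ≤ 4 * q := by
  set A := Finset.Icc 1 q.sqrt
  have hsub : q.divisors ⊆ A ∪ A.image (q / ·) := by
    intro d hd
    have hdq := Nat.dvd_of_mem_divisors hd
    have hd0 := Nat.pos_of_mem_divisors hd
    rw [Finset.mem_union, Finset.mem_image]
    by_cases h : d ≤ q.sqrt
    · exact Or.inl (Finset.mem_Icc.2 ⟨hd0, h⟩)
    · refine Or.inr ⟨q / d, Finset.mem_Icc.2 ⟨Nat.div_pos (Nat.divisor_le hd) hd0, ?_⟩,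
        Nat.div_div_self hdq hq⟩
      by_contra h'
      have h1 : (q.sqrt + 1) * (q.sqrt + 1) ≤ (q / d) * d := Nat.mul_le_mul (by omega) (by omega)
      rw [Nat.div_mul_cancel hdq] at h1
      exact absurd (Nat.lt_succ_sqrt q) (by simpa using h1)
  have hA : A.card = q.sqrt := by simp [A]
  have hcard : q.divisors.card ≤ 2 * q.sqrt := by
    have h1 := Finset.card_le_card hsub
    have h2 := Finset.card_union_le A (A.image (q / ·))
    have h3 : (A.image (q / ·)).card ≤ A.card := Finset.card_image_le
    omega
  calc q.divisors.card ^ 2 ≤ (2 * q.sqrt) ^ 2 := Nat.pow_le_pow_left hcard 2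
    _ = 4 * (q.sqrt * q.sqrt) := by ring
    _ ≤ 4 * q := Nat.mul_le_mul_left 4 (Nat.sqrt_le q)

lemma sum_Icc_inv_sq_le (n : ℕ) : ∑ d ∈ Finset.Icc 1 n, ((d : ℝ)⁻¹) ^ 2 ≤ 7 / 4 := by
  -- Two terms are kept exactly (`5/4 = 7/4 - 1/2`); the rest telescope.
  have h : ∀ m : ℕ, ∑ d ∈ Finset.Icc 1 (m + 2), ((d : ℝ)⁻¹) ^ 2 ≤ 7 / 4 - 1 / (m + 2) := by
    intro m
    induction m with
    | zero => norm_num [Finset.sum_Icc_succ_top]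
    | succ m ih =>
      rw [show m + 1 + 2 = (m + 2) + 1 by ring, Finset.sum_Icc_succ_top (by omega)]
      have h1 : (((m + 2 + 1 : ℕ) : ℝ)⁻¹) ^ 2 ≤ 1 / (m + 2) - 1 / ((m + 1 : ℕ) + 2) := by
        push_cast
        rw [div_sub_div _ _ (by positivity) (by positivity), inv_pow, inv_eq_one_div,
          div_le_div_iff₀ (by positivity) (by positivity)]
        have : (0 : ℝ) ≤ m := m.cast_nonneg
        nlinarith
      linarith
  have hmono : ∑ d ∈ Finset.Icc 1 n, ((d : ℝ)⁻¹) ^ 2 ≤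
      ∑ d ∈ Finset.Icc 1 (n + 2), ((d : ℝ)⁻¹) ^ 2 :=
    Finset.sum_le_sum_of_subset_of_nonneg (Finset.Icc_subset_Icc_right (by omega))
      fun _ _ _ => by positivity
  have h0 : (0 : ℝ) ≤ 1 / (n + 2) := by positivity
  linarith [h n]

/-- The normalised divisor sum `σ_k(q) / q ^ k`. -/
noncomputable def normalizedSigma (q k : ℕ) : ℝ := (ArithmeticFunction.sigma k q : ℝ) / q ^ k

lemma normalizedSigma_eq_sum {q : ℕ} (hq : q ≠ 0) (k : ℕ) :
    normalizedSigma q k = ∑ d ∈ q.divisors, ((d : ℝ)⁻¹) ^ k := by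
  have hq' : (q : ℝ) ≠ 0 := by exact_mod_cast hq
  rw [normalizedSigma, ArithmeticFunction.sigma_eq_sum_div]
  push_cast
  rw [Finset.sum_div]
  refine Finset.sum_congr rfl fun d hd => ?_
  rw [Nat.cast_div_charZero (Nat.dvd_of_mem_divisors hd), ← div_pow]
  congr 1
  field_simp

lemma normalizedSigma_nonneg (q k : ℕ) : 0 ≤ normalizedSigma q k := by
  unfold normalizedSigma
  positivity

lemma normalizedSigma_zero (q : ℕ) :
    normalizedSigma q 0 = (ArithmeticFunction.sigma 0 q : ℝ) := by
  simp [normalizedSigma]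

lemma one_le_normalizedSigma_zero {q : ℕ} (hq : q ≠ 0) : 1 ≤ normalizedSigma q 0 := by
  rw [normalizedSigma_zero]
  exact_mod_cast ArithmeticFunction.sigma_pos 0 q hq

lemma normalizedSigma_antitone {q : ℕ} (hq : q ≠ 0) : Antitone (normalizedSigma q) := by
  intro k l hkl
  rw [normalizedSigma_eq_sum hq, normalizedSigma_eq_sum hq]
  refine Finset.sum_le_sum fun d hd => pow_le_pow_of_le_one (by positivity) ?_ hkl
  exact inv_le_one_of_one_le₀ (by exact_mod_cast Nat.pos_of_mem_divisors hd)

lemma normalizedSigma_two_le {q : ℕ} (hq : q ≠ 0) : normalizedSigma q 2 ≤ 7 / 4 := by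
  rw [normalizedSigma_eq_sum hq]
  refine (Finset.sum_le_sum_of_subset_of_nonneg ?_ fun _ _ _ => by positivity).trans
    (sum_Icc_inv_sq_le q)
  intro d hd
  exact Finset.mem_Icc.2 ⟨Nat.pos_of_mem_divisors hd, Nat.divisor_le hd⟩

/-- Cauchy–Schwarz: `a_1² ≤ a_0 a_2`. -/
lemma normalizedSigma_one_sq_le {q : ℕ} (hq : q ≠ 0) :
    normalizedSigma q 1 ^ 2 ≤ 2 * normalizedSigma q 0 := by
  have h := Finset.sum_mul_sq_le_sq_mul_sq q.divisors (fun _ => (1 : ℝ)) fun d => (d : ℝ)⁻¹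
  have h2 := normalizedSigma_two_le hq
  have h0 := one_le_normalizedSigma_zero hq
  rw [normalizedSigma_eq_sum hq] at h0 h2
  rw [normalizedSigma_eq_sum hq, normalizedSigma_eq_sum hq]
  simp only [one_mul, one_pow, pow_one, pow_zero] at h h0 ⊢
  nlinarith

lemma normalizedSigma_zero_sq_le {q : ℕ} (hq : q ≠ 0) : normalizedSigma q 0 ^ 2 ≤ 4 * q := by
  rw [normalizedSigma_zero, ArithmeticFunction.sigma_zero_apply]
  exact_mod_cast card_divisors_sq_le hq

/-! ### The normalised recurrence and its bounds -/

/-- The normalised moment `M_{N+1}(q) / q ^ N`. -/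
noncomputable def normalizedMoment (q N : ℕ) : ℝ := stableMoment q (N + 1) / q ^ N

lemma normalizedMoment_eq {q : ℕ} (hq : q ≠ 0) (N : ℕ) :
    normalizedMoment q N = normalizedSigma q N + (∑ k ∈ Finset.range N,
      (N.choose k : ℝ) * normalizedSigma q k * normalizedMoment q (N - 1 - k)) / q := by
  have hq' : (q : ℝ) ≠ 0 := by exact_mod_cast hq
  rw [normalizedMoment, stableMoment_succ hq, Finset.sum_range_succ, Nat.sub_self,
    stableMoment_zero, add_div, add_comm]
  congr 1
  · simp [normalizedSigma]
  · rw [Finset.sum_div, Finset.sum_div]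
    refine Finset.sum_congr rfl fun k hk => ?_
    have hkN := Finset.mem_range.1 hk
    rw [normalizedSigma, normalizedMoment, show N - 1 - k + 1 = N - k by omega]
    have hpow : (q : ℝ) ^ N = q ^ k * q ^ (N - 1 - k) * q := by
      rw [← pow_add, ← pow_succ]
      congr 1
      omega
    rw [hpow]
    field_simp

lemma cube_le_four_mul_two_pow (N : ℕ) : N ^ 3 ≤ 4 * 2 ^ N := by
  rcases lt_or_ge N 4 with h | h
  · interval_cases N <;> norm_num
  · induction N, h using Nat.le_induction with
    | base => norm_num
    | succ n hn ih =>
      rw [pow_succ 2 n]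
      nlinarith [Nat.mul_le_mul hn hn, Nat.mul_le_mul (Nat.mul_le_mul hn hn) hn]

section Recurrence

variable {a b : ℕ → ℝ} {Q : ℝ}

/-- Generic terms are at most `C(N,k) · 7/4 · K`. The four indices `0, 1, N-2, N-1`, where a factor
may be unbounded, get separate corrections. -/
lemma sum_choose_mul_le {K : ℝ} (ha : ∀ k, 0 ≤ a k) (hb : ∀ k, 0 ≤ b k) (hK : 0 ≤ K)
    (hsq : a 1 ^ 2 ≤ 2 * a 0) (ha2 : ∀ k, 2 ≤ k → a k ≤ 7 / 4)
    (hb0 : b 0 = a 0) (hb1 : b 1 ≤ K + a 1) {N : ℕ} (hN : 3 ≤ N)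
    (hbK : ∀ j, 2 ≤ j → j < N → b j ≤ K) :
    ∑ k ∈ Finset.range N, (N.choose k : ℝ) * a k * b (N - 1 - k) ≤
      7 / 4 * K * 2 ^ N + K * a 0 + N * (K * a 1 + 2 * a 0) + 7 / 4 * (N * a 0) +
        7 / 4 * (N ^ 2 * a 1) := by
  have hterm : ∀ k ∈ Finset.range N, (N.choose k : ℝ) * a k * b (N - 1 - k) ≤
      (N.choose k : ℝ) * (7 / 4 * K) + (if k = 0 then K * a 0 else 0) +
        (if k = 1 then N * (K * a 1 + 2 * a 0) else 0) +
        (if k = N - 1 then 7 / 4 * (N * a 0) else 0) +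
        (if k = N - 2 then 7 / 4 * (N ^ 2 * a 1) else 0) := by
    intro k hk
    have hkN := Finset.mem_range.1 hk
    have h0 := ha 0
    have h1 := ha 1
    have hN0 : (0 : ℝ) ≤ N := N.cast_nonneg
    rcases Nat.lt_or_ge k 2 with hk2 | hk2
    · interval_cases k
      · have hbN := hbK (N - 1) (by omega) (by omega)
        rw [if_pos rfl, if_neg (by omega), if_neg (by omega), if_neg (by omega)]
        simp only [Nat.choose_zero_right, Nat.cast_one, one_mul, Nat.sub_zero]
        nlinarith
      · rw [if_neg (by omega), if_pos rfl, if_neg (by omega), Nat.choose_one_right]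
        -- For `N = 3` the cofactor is `b 1`; the resulting `a 1 ^ 2` is absorbed by `2 * a 0`.
        have hx : a 1 * b (N - 1 - 1) ≤ K * a 1 + 2 * a 0 := by
          rcases hN.lt_or_eq with h | h
          · have hbN := hbK (N - 1 - 1) (by omega) (by omega)
            nlinarith
          · rw [← h]
            nlinarith
        have hpos : 0 ≤ (if 1 = N - 2 then 7 / 4 * ((N : ℝ) ^ 2 * a 1) else 0) := by
          split_ifs <;> positivity
        have := mul_le_mul_of_nonneg_left hx hN0
        have : 0 ≤ (N : ℝ) * (7 / 4 * K) := by positivity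
        linarith
    · have hak := ha2 k hk2
      have hak0 := ha k
      have hc0 : (0 : ℝ) ≤ N.choose k := Nat.cast_nonneg _
      rw [if_neg (by omega), if_neg (by omega), add_zero, add_zero, mul_assoc]
      rcases (show k = N - 1 ∨ k = N - 2 ∨ 2 ≤ N - 1 - k by omega) with h | h | h
      · rw [if_pos h, if_neg (by omega), h, Nat.sub_self, hb0, ← h]
        have hc : N.choose k = N := by
          rw [h, Nat.choose_symm (show 1 ≤ N by omega), Nat.choose_one_right]
        rw [hc]
        have : a k * a 0 ≤ 7 / 4 * a 0 := mul_le_mul_of_nonneg_right hak h0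
        have := mul_le_mul_of_nonneg_left this hN0
        have : 0 ≤ (N : ℝ) * (7 / 4 * K) := by positivity
        linarith
      · rw [if_neg (by omega), if_pos h, show N - 1 - k = 1 by omega]
        have hc : (N.choose k : ℝ) ≤ N ^ 2 := by
          rw [h, Nat.choose_symm (show 2 ≤ N by omega)]
          exact_mod_cast Nat.choose_le_pow N 2
        have h2 : a k * b 1 ≤ 7 / 4 * K + 7 / 4 * a 1 := by
          have := mul_le_mul hak hb1 (hb 1) (by norm_num)
          linarith
        have h3 := mul_le_mul_of_nonneg_left h2 hc0
        have h4 := mul_le_mul_of_nonneg_right hc (show 0 ≤ 7 / 4 * a 1 by positivity)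
        linarith
      · rw [if_neg (by omega), if_neg (by omega)]
        have := mul_le_mul hak (hbK (N - 1 - k) h (by omega)) (hb _) (by norm_num)
        have := mul_le_mul_of_nonneg_left this hc0
        linarith
  refine (Finset.sum_le_sum hterm).trans ?_
  have hchoose : ∑ k ∈ Finset.range N, (N.choose k : ℝ) ≤ 2 ^ N := by
    have h : ∑ k ∈ Finset.range (N + 1), (N.choose k : ℝ) = 2 ^ N := by
      exact_mod_cast congrArg (Nat.cast (R := ℝ)) (Nat.sum_range_choose N)
    rw [← h, Finset.sum_range_succ]
    exact le_add_of_nonneg_right (Nat.cast_nonneg _)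
  have := mul_le_mul_of_nonneg_right hchoose (show 0 ≤ 7 / 4 * K by positivity)
  simp only [Finset.sum_add_distrib, Finset.sum_ite_eq', Finset.mem_range, ← Finset.sum_mul]
  rw [if_pos (by omega), if_pos (by omega), if_pos (by omega), if_pos (by omega)]
  linarith

variable (ha : ∀ k, 0 ≤ a k) (hb : ∀ k, 0 ≤ b k) (hQ : 0 < Q)
  (hrec : ∀ N : ℕ, b N = a N + (∑ k ∈ Finset.range N, (N.choose k : ℝ) * a k * b (N - 1 - k)) / Q)
  (h10 : a 1 ≤ a 0) (h0Q : a 0 ^ 2 ≤ 4 * Q) (hsq : a 1 ^ 2 ≤ 2 * a 0)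
  (ha2 : ∀ k, 2 ≤ k → a k ≤ 7 / 4)
  (hsmall : ∀ N : ℕ, (2 : ℝ) ^ (N + 1) ≤ Q → N ^ 2 * a 0 ≤ Q / 64)

include hrec in
lemma recurrence_zero : b 0 = a 0 := by simpa using hrec 0

include hrec in
lemma recurrence_one : b 1 = a 1 + a 0 ^ 2 / Q := by
  rw [hrec 1]
  simp [recurrence_zero hrec, sq]

include hQ hrec h0Q in
lemma recurrence_one_le : b 1 ≤ 4 + a 1 := by
  have : a 0 ^ 2 / Q ≤ 4 := (div_le_iff₀ hQ).2 h0Q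
  rw [recurrence_one hrec]
  linarith

include hrec in
lemma recurrence_two : b 2 = a 2 + (3 * (a 0 * a 1) + a 0 ^ 3 / Q) / Q := by
  rw [hrec 2]
  simp only [Finset.sum_range_succ, Finset.sum_range_zero, Nat.choose_zero_right,
    Nat.choose_one_right, Nat.cast_one, Nat.cast_ofNat,
    show 2 - 1 - 1 = 0 from rfl, show 2 - 1 = 1 from rfl, recurrence_zero hrec,
    recurrence_one hrec]
  ring

include ha hb hQ hrec h10 h0Q hsq ha2 hsmall in
-- The induction closes because `2 ^ N ≤ Q / 2` makes the main term `7/4 * 32 * 2 ^ N` at most `28 *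
-- Q`; `hsmall` makes the corrections a small multiple of `Q`.
lemma recurrence_le (N : ℕ) (hN : 2 ≤ N) (hNQ : (2 : ℝ) ^ (N + 1) ≤ Q) : b N ≤ 32 := by
  induction N using Nat.strong_induction_on with
  | _ N ih =>
    have h0 := ha 0
    have hs := hsmall N hNQ
    rcases hN.eq_or_lt with rfl | hN3
    · rw [recurrence_two hrec]
      have h1 : a 0 ^ 3 / Q ≤ 4 * a 0 := by
        rw [div_le_iff₀ hQ]
        nlinarith
      have h2 : (3 * (a 0 * a 1) + a 0 ^ 3 / Q) / Q ≤ 30 := by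
        rw [div_le_iff₀ hQ]
        norm_num at hs
        nlinarith
      linarith [ha2 2 le_rfl]
    · have hle := sum_choose_mul_le (K := 32) ha hb (by norm_num) hsq ha2 (recurrence_zero hrec)
        (by linarith [recurrence_one_le hQ hrec h0Q]) hN3 fun j hj hjN =>
          ih j hjN hj ((pow_le_pow_right₀ (by norm_num) (by omega)).trans hNQ)
      have hN' : (3 : ℝ) ≤ N := by exact_mod_cast hN3
      have hx : (N : ℝ) * a 1 ≤ N * a 0 := mul_le_mul_of_nonneg_left h10 (by linarith)
      have hx2 : (N : ℝ) ^ 2 * a 1 ≤ N ^ 2 * a 0 := mul_le_mul_of_nonneg_left h10 (by positivity)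
      have hNt : 3 * (N * a 0) ≤ (N : ℝ) ^ 2 * a 0 := by
        nlinarith [mul_nonneg (show (0 : ℝ) ≤ N by linarith) h0]
      have hNt' : 3 * a 0 ≤ N * a 0 := by nlinarith
      rw [pow_succ] at hNQ
      rw [hrec N]
      have : (∑ k ∈ Finset.range N, (N.choose k : ℝ) * a k * b (N - 1 - k)) / Q ≤ 30 := by
        rw [div_le_iff₀ hQ]
        linarith
      linarith [ha2 N hN]

include ha hb hQ hrec h10 h0Q hsq ha2 hsmall in
lemma recurrence_sub_le {N : ℕ} (hN : 3 ≤ N) (hNQ : (2 : ℝ) ^ (N + 1) ≤ Q) :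
    b N - a N ≤ 100 * ((N + 1) * a 0 + 2 ^ (N + 1)) / Q := by
  have hle := sum_choose_mul_le (K := 32) ha hb (by norm_num) hsq ha2 (recurrence_zero hrec)
    (by linarith [recurrence_one_le hQ hrec h0Q]) hN fun j hj hjN =>
      recurrence_le ha hb hQ hrec h10 h0Q hsq ha2 hsmall j hj
        ((pow_le_pow_right₀ (by norm_num) (by omega)).trans hNQ)
  have h0 := ha 0
  have hN' : (3 : ℝ) ≤ N := by exact_mod_cast hN
  have hcube : (N : ℝ) ^ 3 ≤ 4 * 2 ^ N := by exact_mod_cast cube_le_four_mul_two_pow N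
  have hx : (N : ℝ) * a 1 ≤ N * a 0 := mul_le_mul_of_nonneg_left h10 (by linarith)
  -- Using `a 1 ≤ a 0` here would cost `N ^ 2 * a 0`; AM-GM with `a 1 ^ 2 ≤ 2 * a 0` leaves `N ^ 3`,
  -- which `2 ^ N` absorbs.
  have hx2 : (N : ℝ) ^ 2 * a 1 ≤ N ^ 3 + 2 * (N * a 0) := by
    have h1 : (N : ℝ) * a 1 ≤ N ^ 2 + 2 * a 0 := by nlinarith [sq_nonneg ((N : ℝ) - a 1)]
    have := mul_le_mul_of_nonneg_left h1 (show (0 : ℝ) ≤ N by linarith)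
    linarith
  have hNt : 0 ≤ N * a 0 := mul_nonneg (by linarith) h0
  have hp : (0 : ℝ) ≤ 2 ^ N := by positivity
  rw [hrec N, add_sub_cancel_left]
  refine div_le_div_of_nonneg_right (hle.trans ?_) hQ.le
  rw [pow_succ (2 : ℝ) N]
  linarith

end Recurrence

/-! ### The threshold for `q` -/

/-- `262144 = 16 * 4 * 64 ^ 2` is what `sq_mul_normalizedSigma_zero_le` needs after squaring. -/
lemma eventually_log_pow_four_le :
    ∃ q₀ : ℕ, ∀ q : ℕ, q₀ ≤ q → Real.log q ^ 4 ≤ (q : ℝ) / 262144 := by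
  have h := (Real.isLittleO_pow_log_id_atTop (n := 4)).comp_tendsto
    tendsto_natCast_atTop_atTop
  obtain ⟨q₀, hq₀⟩ := Filter.eventually_atTop.1
    (h.bound (show (0 : ℝ) < 1 / 262144 by norm_num))
  refine ⟨q₀, fun q hq => ?_⟩
  have := hq₀ q hq
  simp only [Function.comp_apply, id, Real.norm_eq_abs, Nat.abs_cast] at this
  linarith [le_abs_self (Real.log q ^ 4)]

lemma sq_mul_normalizedSigma_zero_le {q : ℕ} (hq : q ≠ 0)
    (hlog : Real.log q ^ 4 ≤ (q : ℝ) / 262144) {N : ℕ} (hN : (2 : ℝ) ^ (N + 1) ≤ q) :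
    N ^ 2 * normalizedSigma q 0 ≤ (q : ℝ) / 64 := by
  have hq' : (0 : ℝ) < q := by exact_mod_cast Nat.pos_of_ne_zero hq
  have h1 : (N : ℝ) ≤ 2 * Real.log q := by
    have h := Real.log_le_log (by positivity) hN
    rw [Real.log_pow] at h
    push_cast at h
    nlinarith [Real.log_two_gt_d9, N.cast_nonneg (α := ℝ)]
  have h2 : (N : ℝ) ^ 4 ≤ 16 * Real.log q ^ 4 := by
    calc (N : ℝ) ^ 4 ≤ (2 * Real.log q) ^ 4 := pow_le_pow_left₀ N.cast_nonneg h1 4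
      _ = _ := by ring
  refine (pow_le_pow_iff_left₀ (mul_nonneg (by positivity) (normalizedSigma_nonneg q 0))
    (by positivity) two_ne_zero).1 ?_
  calc (N ^ 2 * normalizedSigma q 0) ^ 2 = (N : ℝ) ^ 4 * normalizedSigma q 0 ^ 2 := by ring
    _ ≤ (16 * ((q : ℝ) / 262144)) * (4 * q) :=
      mul_le_mul (h2.trans (by linarith)) (normalizedSigma_zero_sq_le hq) (by positivity)
        (by positivity)
    _ = (q / 64) ^ 2 := by ring

/-! ### The cases of the theorem -/

lemma stableMoment_one {q : ℕ} (hq : q ≠ 0) :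
    stableMoment q 1 = (ArithmeticFunction.sigma 0 q : ℝ) := by
  rw [stableMoment_succ hq]
  simp [stableMoment_zero]

lemma stableMoment_two {q : ℕ} (hq : q ≠ 0) :
    stableMoment q 2 =
      (ArithmeticFunction.sigma 1 q : ℝ) + (ArithmeticFunction.sigma 0 q : ℝ) ^ 2 := by
  rw [stableMoment_succ hq]
  simp only [Finset.sum_range_succ, Finset.sum_range_zero, Nat.sub_zero, Nat.sub_self,
    Nat.choose_zero_right, Nat.choose_self, stableMoment_zero, stableMoment_one hq, Nat.cast_one]
  ring

lemma stableMoment_three {q : ℕ} (hq : q ≠ 0) :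
    stableMoment q 3 = (ArithmeticFunction.sigma 2 q : ℝ) +
      3 * ((ArithmeticFunction.sigma 0 q : ℝ) * (ArithmeticFunction.sigma 1 q : ℝ)) +
      (ArithmeticFunction.sigma 0 q : ℝ) ^ 3 := by
  rw [stableMoment_succ hq]
  simp only [Finset.sum_range_succ, Finset.sum_range_zero, Nat.sub_zero, Nat.sub_self,
    show 2 - 1 = 1 from rfl, Nat.choose_one_right, Nat.cast_ofNat,
    Nat.choose_zero_right, Nat.choose_self, stableMoment_zero, stableMoment_one hq,
    stableMoment_two hq, Nat.cast_one]
  ring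

lemma sigma_zero_sq_le_four_mul_sigma_one {q : ℕ} (hq : q ≠ 0) :
    (ArithmeticFunction.sigma 0 q : ℝ) ^ 2 ≤ 4 * (ArithmeticFunction.sigma 1 q : ℝ) := by
  have h : q ≤ ArithmeticFunction.sigma 1 q := by
    rw [ArithmeticFunction.sigma_one_apply]
    exact Finset.single_le_sum (f := fun d => d) (fun _ _ => Nat.zero_le _)
      (Nat.mem_divisors_self q hq)
  have h' : (q : ℝ) ≤ ArithmeticFunction.sigma 1 q := by exact_mod_cast h
  have := normalizedSigma_zero_sq_le hq
  rw [normalizedSigma_zero] at this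
  linarith

lemma abs_stableMoment_three_sub_le {q : ℕ} (hq : q ≠ 0) :
    |stableMoment q 3 - (ArithmeticFunction.sigma 2 q : ℝ)| ≤
      100 * ((ArithmeticFunction.sigma 0 q : ℝ) * (ArithmeticFunction.sigma 1 q : ℝ)) := by
  have h0 : (0 : ℝ) ≤ ArithmeticFunction.sigma 0 q := Nat.cast_nonneg _
  have h1 : (0 : ℝ) ≤ ArithmeticFunction.sigma 1 q := Nat.cast_nonneg _
  -- This turns `σ₀³` into `4 σ₀ σ₁`, so the constant `7` would already do.
  have h := mul_le_mul_of_nonneg_left (sigma_zero_sq_le_four_mul_sigma_one hq) h0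
  have h01 := mul_nonneg h0 h1
  have h3 := pow_nonneg h0 3
  rw [stableMoment_three hq, abs_of_nonneg (by linarith)]
  linarith

lemma abs_stableMoment_sub_le {q : ℕ} (hq : q ≠ 0) (hlog : Real.log q ^ 4 ≤ (q : ℝ) / 262144)
    {δ : ℕ} (hδ : 4 ≤ δ) (hδq : (2 : ℝ) ^ δ ≤ q) :
    |stableMoment q δ - (ArithmeticFunction.sigma (δ - 1) q : ℝ)| ≤
      100 * ((q : ℝ) ^ (δ - 2) *
        ((δ : ℝ) * (ArithmeticFunction.sigma 0 q : ℝ) + (2 : ℝ) ^ δ)) := by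
  obtain ⟨N, rfl⟩ : ∃ N, δ = N + 2 := ⟨δ - 2, by omega⟩
  have hq' : (0 : ℝ) < q := by exact_mod_cast Nat.pos_of_ne_zero hq
  have hb : ∀ k, 0 ≤ normalizedMoment q k := fun k =>
    div_nonneg (stableMoment_nonneg q _) (by positivity)
  have hrec := normalizedMoment_eq hq
  have hle := recurrence_sub_le (normalizedSigma_nonneg q) hb hq' hrec
    (normalizedSigma_antitone hq zero_le_one) (normalizedSigma_zero_sq_le hq)
    (normalizedSigma_one_sq_le hq)
    (fun k hk => (normalizedSigma_antitone hq hk).trans (normalizedSigma_two_le hq))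
    (fun M hM => sq_mul_normalizedSigma_zero_le hq hlog hM) (N := N + 1) (by omega) hδq
  have hdiff : stableMoment q (N + 2) - (ArithmeticFunction.sigma (N + 1) q : ℝ) =
      q ^ (N + 1) * (normalizedMoment q (N + 1) - normalizedSigma q (N + 1)) := by
    rw [normalizedMoment, normalizedSigma]
    field_simp
  have hnonneg : 0 ≤ normalizedMoment q (N + 1) - normalizedSigma q (N + 1) := by
    rw [hrec, add_sub_cancel_left]
    exact div_nonneg (Finset.sum_nonneg fun k _ => mul_nonneg
      (mul_nonneg (Nat.cast_nonneg _) (normalizedSigma_nonneg q k)) (hb _)) hq'.le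
  rw [show N + 2 - 1 = N + 1 by omega, show N + 2 - 2 = N by omega, hdiff,
    abs_of_nonneg (mul_nonneg (by positivity) hnonneg)]
  refine (mul_le_mul_of_nonneg_left hle (by positivity)).trans (le_of_eq ?_)
  rw [normalizedSigma_zero]
  push_cast
  field_simp
  ring

theorem mainTheorem3 :
    ∃ (q₀ : ℕ) (C : ℝ), ∀ q : ℕ, q₀ ≤ q →
      ∀ δ : ℕ, 1 ≤ δ → (δ : ℝ) ≤ Real.log q / Real.log 2 →
      ∀ n : ℕ, δ * q ≤ n →
        (δ = 1 → fixedPointMoment n q δ = (ArithmeticFunction.sigma 0 q : ℝ)) ∧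
        (δ = 2 → fixedPointMoment n q δ =
          (ArithmeticFunction.sigma 1 q : ℝ) + (ArithmeticFunction.sigma 0 q : ℝ) ^ 2) ∧
        (δ = 3 → |fixedPointMoment n q δ - (ArithmeticFunction.sigma 2 q : ℝ)| ≤
          C * ((ArithmeticFunction.sigma 0 q : ℝ) * (ArithmeticFunction.sigma 1 q : ℝ))) ∧
        (4 ≤ δ → |fixedPointMoment n q δ - (ArithmeticFunction.sigma (δ - 1) q : ℝ)| ≤
          C * ((q : ℝ) ^ (δ - 2) *
            ((δ : ℝ) * (ArithmeticFunction.sigma 0 q : ℝ) + (2 : ℝ) ^ δ))) := by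
  obtain ⟨q₀, hq₀⟩ := eventually_log_pow_four_le
  refine ⟨max q₀ 1, 100, fun q hqq δ _ hδq n hn => ?_⟩
  have hq : q ≠ 0 := by
    have := (le_max_right q₀ 1).trans hqq
    omega
  rw [fixedPointMoment_eq_stableMoment hq hn]
  refine ⟨?_, ?_, ?_, fun hδ => abs_stableMoment_sub_le hq
    (hq₀ q ((le_max_left _ _).trans hqq)) hδ ?_⟩
  · rintro rfl
    exact stableMoment_one hq
  · rintro rfl
    exact stableMoment_two hq
  · rintro rfl
    exact abs_stableMoment_three_sub_le hq
  -- The logarithmic bound on `δ` is `2 ^ δ ≤ q`, the range in which the recurrence is controlled.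
  · have hq' : (0 : ℝ) < q := by exact_mod_cast Nat.pos_of_ne_zero hq
    rw [le_div_iff₀ (Real.log_pos one_lt_two), ← Real.log_pow] at hδq
    exact (Real.log_le_log_iff (by positivity) hq').1 hδq
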